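/- There are universal constants $c_0, C_0 > 0$ and $d_0 \in \mathbb{N}$ such that the following holds for every $d \ge d_0$. Let $X \subseteq \mathbb{R}^d$ be a full-dimensional convex simplicial polytope (a convex polytope with nonempty interior all of whose facets are simplices) with $m$ facets. Let $q_1, q_2, \dots$ be independent random points, each uniformly distributed in $X$, and let $Q_N$ be the convex hull of $\{q_1, \dots, q_N\}$. If $N > C_0^d\, m$, then $$\mathbb{E}\,\mathrm{Vol}(Q_N) \ge \bigl(1 - e^{-c_0\sqrt d}\bigr)\,\mathrm{Vol}(X)$$ and $$\mathbb{P}\Bigl(\mathrm{Vol}(Q_N) \ge \bigl(1 - e^{-c_0\sqrt d}\bigr)\,\mathrm{Vol}(X)\Bigr) \ge 1 - e^{-c_0\sqrt d}.$$ -/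

import Mathlib

open MeasureTheory ProbabilityTheory

/-- A convex polytope: the convex hull of a finite set of points. -/
def IsConvexPolytope {E : Type*} [AddCommGroup E] [Module ℝ E] (X : Set E) : Prop :=
  ∃ V : Finset E, X = convexHull ℝ (V : Set E)

/-- A simplex (of any dimension): the convex hull of a finite nonempty affinely independent set. -/
def IsGeomSimplex {E : Type*} [AddCommGroup E] [Module ℝ E] (F : Set E) : Prop :=
  ∃ V : Finset E, V.Nonempty ∧ AffineIndependent ℝ (fun v : V => (v : E)) ∧
    F = convexHull ℝ (V : Set E)

/-- A facet of `X`: a nonempty face of `X` (the set of maximizers over `X` of a continuous linear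
functional) whose dimension is one less than the dimension of `X`. -/
def IsFacet {E : Type*} [NormedAddCommGroup E] [NormedSpace ℝ E] (X F : Set E) : Prop :=
  F.Nonempty ∧ IsExposed ℝ X F ∧
    Module.finrank ℝ (vectorSpan ℝ F) + 1 = Module.finrank ℝ (vectorSpan ℝ X)

/-- A convex simplicial polytope: a convex polytope all of whose facets are simplices. -/
def IsSimplicialPolytope {E : Type*} [NormedAddCommGroup E] [NormedSpace ℝ E] (X : Set E) :
    Prop :=
  IsConvexPolytope X ∧ ∀ F : Set E, IsFacet X F → IsGeomSimplex F

/-- The convex hull of the first `N` points of the random sequence `q`, at the outcome `ω`. -/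
def sampleHull {Ω E : Type*} [AddCommGroup E] [Module ℝ E] (q : ℕ → Ω → E) (N : ℕ) (ω : Ω) :
    Set E :=
  convexHull ℝ ((fun i => q i ω) '' Set.Iio N)

/-!
Fix an interior point `o` of the simplicial polytope `X`. The cones `conv (o, F)` over the `m`
facets `F` are simplices that are almost disjoint and cover `X` up to a null set
(`measure_diff_iUnion_convexHull_insert_facets`, `measure_convexHull_insert_inter_facets`,
`IsFacet.exists_affineBasis`), so it is enough to fill most of each of them. The cones of volume
below `exp (-2d) / m` times that of `X` can be given up altogether.

Let `S` be a simplex with barycentric coordinates `x₀, …, x_d`. For `x ∈ S` let `Aᵢ` be the set of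
`a ∈ S` with `aⱼ ≤ xⱼ` for all `j ≠ i`. A point set that meets every `Aᵢ` has `x` in its convex hull
(`mem_convexHull_of_coord_le`): no linear functional separates `x` from it, since the point in `Aᵢ`,
where the `i`-th vertex maximizes the functional, has at least the value of `x`. In the
coordinates `(xⱼ)_{j ≠ i}` the set `Aᵢ` is a box of volume `∏_{j ≠ i} xⱼ`, and comparing `S` with
`∫ exp (d (1 - ∑ yⱼ)) dy` shows that this is at least `exp (-9d)` of the volume of `S`
unless `∏_{j ≠ i} xⱼ < (exp (-8) / d) ^ d`. By a Markov bound with the integrable weight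
`∏ yⱼ ^ (-1/2) exp (-d yⱼ)` (`volume_cornerSimplex_prod_lt_le`), the exceptional points form a
fraction of `S` of at most `exp (-2d)` for each `i`.

With `N > exp 12 ^ d * m` independent points, each non-exceptional `x` in a cone that is not given
up has all its sets `Aᵢ` hit except with probability `(d + 1) exp (-exp d)`
(`prob_notMem_sampleHull_le`). By Tonelli the expected missed volume is at most
`(2d + 3) exp (-2d)` times that of `X`, and Markov's inequality gives both claims
(`volume_sampleHull_bounds`).
-/

/-! ### Barycentric coordinates and the corner regions of a simplex -/

/-- If for every `i` the finite set `s` contains a point whose barycentric coordinates other than the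
`i`-th are at most those of `x`, then `x` lies in the convex hull of `s`. -/
theorem mem_convexHull_of_coord_le {ι E : Type*} [Fintype ι] [NormedAddCommGroup E]
    [NormedSpace ℝ E] (b : AffineBasis ι ℝ E) {s : Set E} (hs : s.Finite) {x : E}
    (h : ∀ i, ∃ a ∈ s, ∀ j, j ≠ i → b.coord j a ≤ b.coord j x) : x ∈ convexHull ℝ s := by
  by_contra hx
  obtain ⟨f, u, hfs, hfx⟩ := geometric_hahn_banach_closed_point (convex_convexHull ℝ s)
    (hs.isClosed_convexHull (𝕜 := ℝ)) hx
  have := b.nonempty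
  obtain ⟨i, hi⟩ := Finite.exists_max fun i => f (b i)
  obtain ⟨a, has, ha⟩ := h i
  -- `i` maximizes `f` over the vertices; the point of `s` provided for this `i` is not separated.
  have key : ∀ y : E, f y = f (b i) + ∑ j, b.coord j y * (f (b j) - f (b i)) := by
    intro y
    conv_lhs => rw [← b.linear_combination_coord_eq_self y]
    simp only [map_sum, map_smul, smul_eq_mul, mul_sub, Finset.sum_sub_distrib, ← Finset.sum_mul,
      b.sum_coord_apply_eq_one]
    ring
  have h1 : f a < f x := (hfs a (subset_convexHull ℝ s has)).trans hfx
  rw [key a, key x] at h1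
  refine absurd h1 (not_lt.mpr ?_)
  gcongr _ + ?_
  refine Finset.sum_le_sum fun j _ => ?_
  by_cases hj : j = i
  · simp [hj]
  · exact mul_le_mul_of_nonpos_right (ha j hj) (sub_nonpos.mpr (hi j))

/-- The barycentric coordinates other than the `i`-th one. -/
noncomputable def cornerChart {ι E : Type*} [AddCommGroup E] [Module ℝ E]
    (b : AffineBasis ι ℝ E) (i : ι) (x : E) : {j // j ≠ i} → ℝ :=
  fun j => b.coord j x

/-- The chart is a translation followed by the coordinate map of a linear basis, hence it scales
Haar measure by a constant. -/
theorem cornerChart_eq {ι E : Type*} [Fintype ι] [AddCommGroup E] [Module ℝ E]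
    (b : AffineBasis ι ℝ E) (i : ι) (x : E) :
    cornerChart b i x = (b.basisOf i).equivFun (x - b i) := by
  classical
  have hx : x - b i = ∑ j : {j // j ≠ i}, cornerChart b i x j • b.basisOf i j := by
    have h2 := Fintype.sum_eq_add_sum_subtype_ne (fun j => b.coord j x • (b j - b i)) i
    simp only [sub_self, smul_zero, zero_add] at h2
    simp only [AffineBasis.basisOf_apply, vsub_eq_sub, cornerChart]
    rw [← h2]
    simp only [smul_sub, Finset.sum_sub_distrib, ← Finset.sum_smul, b.sum_coord_apply_eq_one,
      b.linear_combination_coord_eq_self, one_smul]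
  rw [hx, ← Module.Basis.equivFun_symm_apply, LinearEquiv.apply_symm_apply]

theorem measurable_cornerChart {ι E : Type*} [Fintype ι] [NormedAddCommGroup E]
    [NormedSpace ℝ E] [FiniteDimensional ℝ E] [MeasurableSpace E] [BorelSpace E]
    (b : AffineBasis ι ℝ E) (i : ι) : Measurable (cornerChart b i) := by
  refine measurable_pi_lambda _ fun j => ?_
  exact (AffineMap.continuous_of_finiteDimensional (b.coord j)).measurable

theorem exists_measure_preimage_cornerChart {ι E : Type*} [Fintype ι] [DecidableEq ι]
    [NormedAddCommGroup E] [NormedSpace ℝ E] [FiniteDimensional ℝ E] [MeasurableSpace E]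
    [BorelSpace E] (μ : Measure E) [μ.IsAddHaarMeasure] (b : AffineBasis ι ℝ E) (i : ι) :
    ∃ c : ENNReal, ∀ T : Set ({j // j ≠ i} → ℝ), MeasurableSet T →
      μ (cornerChart b i ⁻¹' T) = c * volume T := by
  classical
  set L := (b.basisOf i).equivFun
  have : (μ.map L).IsAddHaarMeasure := L.toContinuousLinearEquiv.isAddHaarMeasure_map μ
  have hL : Measurable L := (LinearMap.continuous_of_finiteDimensional L.toLinearMap).measurable
  refine ⟨Measure.addHaarScalarFactor (μ.map L) volume, fun T hT => ?_⟩
  have h1 : cornerChart b i ⁻¹' T = (fun x => x + (-b i)) ⁻¹' (L ⁻¹' T) := by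
    ext x; simp [cornerChart_eq, L, sub_eq_add_neg]
  rw [h1, measure_preimage_add_right, ← Measure.map_apply hL hT]
  conv_lhs => rw [Measure.isAddLeftInvariant_eq_smul (μ.map L) volume]
  rfl

/-! ### Integral estimates over the corner simplex -/

/-- Markov's inequality for a product function: a set on which `∏ φ (xⱼ) ≥ a` almost everywhere has
volume at most `(∫ φ) ^ card κ / a`. -/
theorem volume_le_of_le_prod {κ : Type*} [Fintype κ] {φ : ℝ → ℝ} (hφ : Integrable φ)
    (hφ0 : ∀ t, 0 ≤ φ t) {A : Set (κ → ℝ)} {a : ℝ} (ha : 0 < a)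
    (hA : ∀ᵐ x, x ∈ A → a ≤ ∏ j, φ (x j)) :
    volume A ≤ ENNReal.ofReal ((∫ t, φ t) ^ Fintype.card κ / a) := by
  have hint : Integrable (fun x : κ → ℝ => ∏ j, φ (x j)) := Integrable.fintype_prod (fun _ => hφ)
  have h0 : ∀ x : κ → ℝ, 0 ≤ ∏ j, φ (x j) := fun x => Finset.prod_nonneg fun j _ => hφ0 _
  have h1 : volume A ≤ volume {x : κ → ℝ | ENNReal.ofReal a ≤ ENNReal.ofReal (∏ j, φ (x j))} := by
    refine measure_mono_ae ?_
    filter_upwards [hA] with x hx hxA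
    exact ENNReal.ofReal_le_ofReal (hx hxA)
  have h2 := mul_meas_ge_le_lintegral₀ hint.aestronglyMeasurable.aemeasurable.ennreal_ofReal
    (ENNReal.ofReal a)
  rw [← ofReal_integral_eq_lintegral_ofReal hint (Filter.Eventually.of_forall h0),
    integral_fintype_prod_volume_eq_pow] at h2
  rw [ENNReal.ofReal_div_of_pos ha, ENNReal.le_div_iff_mul_le (by simp [ha]) (by simp), mul_comm]
  exact (mul_le_mul_right h1 _).trans h2

/-- The standard corner simplex `{y ≥ 0, ∑ y ≤ 1}`. -/
def cornerSimplex (κ : Type*) [Fintype κ] : Set (κ → ℝ) :=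
  {y | (∀ j, 0 ≤ y j) ∧ ∑ j, y j ≤ 1}

theorem measurableSet_cornerSimplex (κ : Type*) [Fintype κ] :
    MeasurableSet (cornerSimplex κ) := by
  refine IsClosed.measurableSet ?_
  refine IsClosed.inter (s₁ := {y : κ → ℝ | ∀ j, 0 ≤ y j}) (s₂ := {y : κ → ℝ | ∑ j, y j ≤ 1}) ?_ ?_
  · rw [Set.ofPred_forall]
    exact isClosed_iInter fun j => isClosed_le continuous_const (continuous_apply j)
  · exact isClosed_le (by fun_prop) continuous_const

theorem volume_cornerSimplex_le (κ : Type*) [Fintype κ] {n : ℕ} (hn : Fintype.card κ = n)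
    (hn0 : 0 < n) :
    volume (cornerSimplex κ) ≤ ENNReal.ofReal ((Real.exp 1 / n) ^ n) := by
  have hn' : (0 : ℝ) < n := by exact_mod_cast hn0
  have h := volume_le_of_le_prod (κ := κ) (A := cornerSimplex κ)
    (φ := Set.indicator (Set.Ioi 0) fun t => Real.exp (-n * t)) (a := Real.exp (-n)) ?_ ?_
    (Real.exp_pos _) ?_
  · refine h.trans (ENNReal.ofReal_le_ofReal (le_of_eq ?_))
    rw [integral_indicator measurableSet_Ioi, integral_exp_mul_Ioi (by linarith), hn,
      Real.exp_neg]
    simp only [mul_zero, Real.exp_zero, div_pow, ← Real.exp_nat_mul, mul_one]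
    field_simp
    rw [← mul_pow, neg_one_mul, div_self (pow_ne_zero _ (neg_ne_zero.mpr hn'.ne'))]
  · rw [integrable_indicator_iff measurableSet_Ioi]
    exact integrableOn_exp_mul_Ioi (by linarith) 0
  · exact fun t => Set.indicator_nonneg (fun _ _ => (Real.exp_pos _).le) t
  · have h0 : ∀ᵐ y : κ → ℝ, ∀ j, y j ≠ 0 := by
      rw [ae_all_iff]
      intro j
      exact measure_eq_zero_iff_ae_notMem.mp (Measure.pi_hyperplane (fun _ => volume) j 0)
    filter_upwards [h0] with y hy0 hy
    have : ∀ j, y j ∈ Set.Ioi (0 : ℝ) := fun j => lt_of_le_of_ne (hy.1 j) (hy0 j).symm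
    simp only [Set.indicator_of_mem (this _), ← Real.exp_sum, ← Finset.mul_sum]
    apply Real.exp_le_exp.mpr
    nlinarith [hy.2]

theorem le_volume_cornerSimplex (κ : Type*) [Fintype κ] {n : ℕ} (hn : Fintype.card κ = n)
    (hn0 : 0 < n) :
    ENNReal.ofReal ((1 / n : ℝ) ^ n) ≤ volume (cornerSimplex κ) := by
  have hn' : (0 : ℝ) < n := by exact_mod_cast hn0
  have h1 : Set.Icc (0 : κ → ℝ) (fun _ => (1 / n : ℝ)) ⊆ cornerSimplex κ := by
    intro y hy
    refine ⟨fun j => hy.1 j, (Finset.sum_le_sum fun j _ => hy.2 j).trans ?_⟩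
    simp [hn, hn'.ne']
  refine le_trans ?_ (measure_mono h1)
  rw [Real.volume_Icc_pi, ENNReal.ofReal_pow (by positivity)]
  simp [hn]

/-- The part of the corner simplex with a small coordinate product is small. On it
`∏ yⱼ ^ (-1/2) * exp (n * (1 - ∑ yⱼ))` is at least `(n / r) ^ (n / 2)`, and this function has
an explicit integral. -/
theorem volume_cornerSimplex_prod_lt_le (κ : Type*) [Fintype κ] {n : ℕ}
    (hn : Fintype.card κ = n) (hn0 : 0 < n) {r : ℝ} (hr : 0 < r) :
    volume {y ∈ cornerSimplex κ | ∏ j, y j < (r / n) ^ n}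
      ≤ ENNReal.ofReal ((Real.exp 1 * √Real.pi * √r / n) ^ n) := by
  have hn' : (0 : ℝ) < n := by exact_mod_cast hn0
  have hI : ∫ t in Set.Ioi (0 : ℝ), t ^ ((1 / 2 : ℝ) - 1) * Real.exp (-(n * t))
      = √Real.pi / √n := by
    rw [Real.integral_rpow_mul_exp_neg_mul_Ioi (by norm_num) hn', Real.Gamma_one_half_eq,
      ← Real.sqrt_eq_rpow, Real.sqrt_div zero_le_one, Real.sqrt_one]
    ring
  have h := volume_le_of_le_prod (κ := κ)
    (A := {y ∈ cornerSimplex κ | ∏ j, y j < (r / n) ^ n})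
    (φ := Set.indicator (Set.Ioi 0) fun t => t ^ ((1 / 2 : ℝ) - 1) * Real.exp (-(n * t)))
    (a := (Real.exp (-1) / √(r / n)) ^ n) ?_ ?_ (by positivity) ?_
  · refine h.trans (ENNReal.ofReal_le_ofReal (le_of_eq ?_))
    rw [integral_indicator measurableSet_Ioi, hI, hn, ← div_pow, Real.exp_neg,
      Real.sqrt_div hr.le]
    congr 1
    have : √(n : ℝ) * √(n : ℝ) = n := Real.mul_self_sqrt hn'.le
    field_simp
    rw [pow_two, this]
  · rw [integrable_indicator_iff measurableSet_Ioi]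
    refine not_not.mp fun hni => ?_
    rw [integral_undef hni] at hI
    have : 0 < √Real.pi / √(n : ℝ) := by positivity
    linarith
  · exact fun t => Set.indicator_nonneg (fun t (ht : 0 < t) => by positivity) t
  · have h0 : ∀ᵐ y : κ → ℝ, ∀ j, y j ≠ 0 := by
      rw [ae_all_iff]
      intro j
      exact measure_eq_zero_iff_ae_notMem.mp (Measure.pi_hyperplane (fun _ => volume) j 0)
    filter_upwards [h0] with y hy0 hy
    have hpos : ∀ j, y j ∈ Set.Ioi (0 : ℝ) := fun j => lt_of_le_of_ne (hy.1.1 j) (hy0 j).symm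
    have hpos' : ∀ j, 0 < y j := hpos
    simp only [Set.indicator_of_mem (hpos _), Finset.prod_mul_distrib, ← Real.exp_sum,
      Finset.sum_neg_distrib, ← Finset.mul_sum]
    have hprod : 0 < ∏ j, y j := Finset.prod_pos fun j _ => hpos' j
    have e1 : (Real.exp (-1) / √(r / n)) ^ n = (√(r / n) ^ n)⁻¹ * Real.exp (-n) := by
      rw [div_pow, ← Real.exp_nat_mul]
      simp [div_eq_mul_inv, mul_comm]
    rw [e1, Real.finsetProd_rpow _ _ (fun j _ => (hpos' j).le)]
    have e2 : (∏ j, y j) ^ ((1 / 2 : ℝ) - 1) = (√(∏ j, y j))⁻¹ := by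
      rw [show (1 / 2 : ℝ) - 1 = -(1 / 2) by norm_num, Real.rpow_neg hprod.le, Real.sqrt_eq_rpow]
    rw [e2]
    gcongr ?_ * ?_
    · gcongr
      refine Real.sqrt_le_iff.mpr ⟨by positivity, ?_⟩
      rw [← pow_mul, mul_comm, pow_mul, Real.sq_sqrt (by positivity)]
      exact hy.2.le
    · apply Real.exp_le_exp.mpr
      nlinarith [hy.1.2]

/-! ### Corner regions fill a substantial part of a simplex -/

/-- The points of the simplex with vertices `b` all of whose barycentric coordinates, except
possibly the `i`-th one, are at most those of `x`. -/
def cornerRegion {ι E : Type*} [AddCommGroup E] [Module ℝ E] (b : AffineBasis ι ℝ E) (i : ι)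
    (x : E) : Set E :=
  {a ∈ convexHull ℝ (Set.range b) | ∀ j, j ≠ i → b.coord j a ≤ b.coord j x}

theorem convexHull_eq_preimage_cornerChart {ι E : Type*} [Fintype ι] [DecidableEq ι]
    [AddCommGroup E] [Module ℝ E] (b : AffineBasis ι ℝ E) (i : ι) :
    convexHull ℝ (Set.range b) = cornerChart b i ⁻¹' cornerSimplex {j // j ≠ i} := by
  rw [b.convexHull_eq_nonneg_coord]
  ext x
  have hsum := Fintype.sum_eq_add_sum_subtype_ne (fun j => b.coord j x) i
  rw [b.sum_coord_apply_eq_one] at hsum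
  constructor
  · intro hx
    refine ⟨fun j => hx j, ?_⟩
    change ∑ j : {j // j ≠ i}, b.coord j x ≤ 1
    have := hx i
    linarith
  · intro hx j
    have h2 : ∑ j : {j // j ≠ i}, b.coord j x ≤ 1 := hx.2
    by_cases hj : j = i
    · subst hj; linarith
    · exact hx.1 ⟨j, hj⟩

theorem cornerRegion_eq_preimage_cornerChart {ι E : Type*} [Fintype ι] [DecidableEq ι]
    [AddCommGroup E] [Module ℝ E] (b : AffineBasis ι ℝ E) (i : ι) {x : E}
    (hx : x ∈ convexHull ℝ (Set.range b)) :
    cornerRegion b i x = cornerChart b i ⁻¹' Set.Icc 0 (cornerChart b i x) := by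
  have hx' := hx
  rw [convexHull_eq_preimage_cornerChart b i] at hx'
  ext a
  rw [cornerRegion, Set.mem_sep_iff, convexHull_eq_preimage_cornerChart b i]
  constructor
  · rintro ⟨h1, h2⟩
    exact ⟨fun j => h1.1 j, fun j => h2 j j.2⟩
  · rintro ⟨h1, h2⟩
    exact ⟨⟨fun j => h1 j, (Finset.sum_le_sum fun j _ => h2 j).trans hx'.2⟩,
      fun j hj => h2 ⟨j, hj⟩⟩

section

variable {ι E : Type*} [Fintype ι] [DecidableEq ι] [NormedAddCommGroup E] [NormedSpace ℝ E]
  [FiniteDimensional ℝ E] [MeasurableSpace E] [BorelSpace E]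

theorem measurableSet_cornerRegion (b : AffineBasis ι ℝ E) (i : ι) {x : E}
    (hx : x ∈ convexHull ℝ (Set.range b)) : MeasurableSet (cornerRegion b i x) := by
  rw [cornerRegion_eq_preimage_cornerChart b i hx]
  exact measurable_cornerChart b i measurableSet_Icc

variable (μ : Measure E) [μ.IsAddHaarMeasure]

theorem card_subtype_ne {n : ℕ} (hn : Fintype.card ι = n + 1) (i : ι) :
    Fintype.card {j // j ≠ i} = n := by
  simp [Fintype.card_subtype_compl, hn]

/-- The factor `(1 / n) ^ n`, lost in passing from the corner simplex to `[0, 1/n]ⁿ`, cancels the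
`n ^ (-n)` of `volume_cornerSimplex_prod_lt_le`, so the bound relative to the simplex is geometric in
`n`. -/
theorem measure_prod_coord_ne_lt_le (b : AffineBasis ι ℝ E) {n : ℕ}
    (hn : Fintype.card ι = n + 1) (hn0 : 0 < n) {r : ℝ} (hr : 0 < r) (i : ι) :
    μ {x ∈ convexHull ℝ (Set.range b) | ∏ j : {j // j ≠ i}, b.coord j x < (r / n) ^ n}
      ≤ ENNReal.ofReal ((Real.exp 1 * √Real.pi * √r) ^ n) *
        μ (convexHull ℝ (Set.range b)) := by
  have hn' : (0 : ℝ) < n := by exact_mod_cast hn0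
  obtain ⟨c, hc⟩ := exists_measure_preimage_cornerChart μ b i
  have hκ := card_subtype_ne hn i
  have h1 : {x ∈ convexHull ℝ (Set.range b) | ∏ j : {j // j ≠ i}, b.coord j x < (r / n) ^ n}
      = cornerChart b i ⁻¹' {y ∈ cornerSimplex {j // j ≠ i} | ∏ j, y j < (r / n) ^ n} := by
    rw [convexHull_eq_preimage_cornerChart b i]; rfl
  have hprod : Measurable fun y : {j // j ≠ i} → ℝ => ∏ j, y j := by fun_prop
  have hm : MeasurableSet {y ∈ cornerSimplex {j // j ≠ i} | ∏ j, y j < (r / n) ^ n} :=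
    (measurableSet_cornerSimplex _).inter (measurableSet_lt hprod measurable_const)
  rw [h1, hc _ hm, convexHull_eq_preimage_cornerChart b i,
    hc _ (measurableSet_cornerSimplex _), mul_left_comm]
  gcongr c * ?_
  refine (volume_cornerSimplex_prod_lt_le _ hκ hn0 hr).trans ?_
  have e : (Real.exp 1 * √Real.pi * √r / n) ^ n
      = (Real.exp 1 * √Real.pi * √r) ^ n * (1 / n : ℝ) ^ n := by rw [← mul_pow, mul_one_div]
  rw [e, ENNReal.ofReal_mul (by positivity)]
  gcongr
  exact le_volume_cornerSimplex _ hκ hn0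

theorem measure_exists_prod_coord_ne_lt_le (b : AffineBasis ι ℝ E) {n : ℕ}
    (hn : Fintype.card ι = n + 1) (hn0 : 0 < n) {r : ℝ} (hr : 0 < r) :
    μ {x ∈ convexHull ℝ (Set.range b) | ∃ i : ι, ∏ j : {j // j ≠ i}, b.coord j x < (r / n) ^ n}
      ≤ (n + 1) * (ENNReal.ofReal ((Real.exp 1 * √Real.pi * √r) ^ n)
        * μ (convexHull ℝ (Set.range b))) := by
  have hsub : {x ∈ convexHull ℝ (Set.range b) |
      ∃ i : ι, ∏ j : {j // j ≠ i}, b.coord j x < (r / n) ^ n} ⊆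
      ⋃ i : ι, {x ∈ convexHull ℝ (Set.range b) |
        ∏ j : {j // j ≠ i}, b.coord j x < (r / n) ^ n} := by
    rintro x ⟨hx, i, hxi⟩
    exact Set.mem_iUnion.mpr ⟨i, hx, hxi⟩
  refine (measure_mono hsub).trans ((measure_iUnion_fintype_le _ _).trans ?_)
  refine (Finset.sum_le_sum fun i _ => measure_prod_coord_ne_lt_le μ b hn hn0 hr i).trans ?_
  simp [hn]

theorem le_measure_cornerRegion (b : AffineBasis ι ℝ E) {n : ℕ} (hn : Fintype.card ι = n + 1)
    (hn0 : 0 < n) {r : ℝ} (hr : 0 < r) (i : ι) {x : E} (hx : x ∈ convexHull ℝ (Set.range b))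
    (hxr : (r / n) ^ n ≤ ∏ j : {j // j ≠ i}, b.coord j x) :
    ENNReal.ofReal ((r / Real.exp 1) ^ n) * μ (convexHull ℝ (Set.range b))
      ≤ μ (cornerRegion b i x) := by
  have hn' : (0 : ℝ) < n := by exact_mod_cast hn0
  obtain ⟨c, hc⟩ := exists_measure_preimage_cornerChart μ b i
  have hκ := card_subtype_ne hn i
  have hx' := hx
  rw [convexHull_eq_preimage_cornerChart b i] at hx'
  rw [cornerRegion_eq_preimage_cornerChart b i hx, hc _ measurableSet_Icc,
    convexHull_eq_preimage_cornerChart b i, hc _ (measurableSet_cornerSimplex _), mul_left_comm]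
  gcongr c * ?_
  calc _ ≤ ENNReal.ofReal ((r / Real.exp 1) ^ n) * ENNReal.ofReal ((Real.exp 1 / n) ^ n) := by
        gcongr; exact volume_cornerSimplex_le _ hκ hn0
    _ = ENNReal.ofReal ((r / n) ^ n) := by
        rw [← ENNReal.ofReal_mul (by positivity), ← mul_pow]
        congr 2
        field_simp
    _ ≤ ENNReal.ofReal (∏ j : {j // j ≠ i}, b.coord j x) := ENNReal.ofReal_le_ofReal hxr
    _ = _ := by
        change ENNReal.ofReal (∏ j, cornerChart b i x j) = _
        rw [Real.volume_Icc_pi, ENNReal.ofReal_prod_of_nonneg fun j _ => hx'.1 j]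
        simp

end

/-! ### Decomposing a polytope into cones over its facets -/

section

variable {E : Type*} [NormedAddCommGroup E] [NormedSpace ℝ E]

theorem IsConvexPolytope.isCompact {X : Set E} (hX : IsConvexPolytope X) : IsCompact X := by
  obtain ⟨V, rfl⟩ := hX
  exact V.finite_toSet.isCompact_convexHull (𝕜 := ℝ)

theorem IsConvexPolytope.convex {X : Set E} (hX : IsConvexPolytope X) : Convex ℝ X := by
  obtain ⟨V, rfl⟩ := hX
  exact convex_convexHull ℝ _

/-- By Krein–Milman a face is determined by its extreme points, which are among the finitely many
points spanning the polytope. -/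
theorem IsConvexPolytope.finite_isExposed {X : Set E} (hX : IsConvexPolytope X) :
    {F : Set E | IsExposed ℝ X F}.Finite := by
  obtain ⟨V, hV⟩ := id hX
  refine Set.Finite.subset
    (V.finite_toSet.finite_subsets.image fun W => closure (convexHull ℝ W)) ?_
  intro F hF
  refine ⟨F.extremePoints ℝ, ?_, ?_⟩
  · refine (hF.isExtreme.extremePoints_subset_extremePoints).trans ?_
    rw [hV]
    exact extremePoints_convexHull_subset
  · exact closure_convexHull_extremePoints (hF.isCompact hX.isCompact) (hF.convex hX.convex)

theorem eq_of_mem_affineSpan {f : StrongDual ℝ E} {s : Set E} {c : ℝ}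
    (hs : ∀ x ∈ s, f x = c) {x : E} (hx : x ∈ affineSpan ℝ s) : f x = c := by
  refine affineSpan_induction hx hs fun t u v w hu hv hw => ?_
  simp [hu, hv, hw]

/-- A facet is cut out by a functional normalized to be `1` on it as seen from the interior point
`o`. Such functionals compare facets with one another along rays from `o`. -/
theorem IsFacet.exists_functional {X F : Set E} (hF : IsFacet X F) {o : E}
    (ho : o ∈ interior X) :
    ∃ f : StrongDual ℝ E, F = {x ∈ X | f (x - o) = 1} ∧ ∀ x ∈ X, f (x - o) ≤ 1 := by
  obtain ⟨⟨y, hy⟩, hexp, hdim⟩ := hF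
  obtain ⟨l, hl⟩ := hexp ⟨y, hy⟩
  have hoX := interior_subset ho
  have hymax : y ∈ X ∧ ∀ z ∈ X, l z ≤ l y := by rw [hl] at hy; exact hy
  have hlt : l o < l y := by
    refine lt_of_le_of_ne (hymax.2 o hoX) fun heq => ?_
    have hloc : IsLocalMax l o := by
      filter_upwards [mem_interior_iff_mem_nhds.mp ho] with z hz
      exact (hymax.2 z hz).trans_eq heq.symm
    have hl0 : l = 0 := hloc.hasFDerivAt_eq_zero l.hasFDerivAt
    have : F = X := by rw [hl]; ext z; simp [hl0]
    rw [this] at hdim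
    omega
  have hpos : 0 < l y - l o := sub_pos.mpr hlt
  refine ⟨(l y - l o)⁻¹ • l, ?_, ?_⟩
  · rw [hl]
    ext z
    refine and_congr_right fun hz => ?_
    rw [smul_apply, smul_eq_mul, map_sub, inv_mul_eq_one₀ hpos.ne']
    constructor
    · intro h; have h1 := h y hymax.1; have h2 := hymax.2 z hz; linarith
    · intro h w hw; have h1 := hymax.2 w hw; linarith
  · intro z hz
    rw [smul_apply, smul_eq_mul, map_sub, inv_mul_le_one₀ hpos]
    linarith [hymax.2 z hz]

/-- The ray from `o` through `x` leaves `X` at a point `y` with a supporting hyperplane, normalized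
as in `IsFacet.exists_functional`. -/
theorem exists_supporting_functional {X : Set E} (hXc : Convex ℝ X) (hXk : IsCompact X) {o x : E}
    (ho : o ∈ interior X) (hx : x ∈ X) (hxo : x ≠ o) :
    ∃ (f : StrongDual ℝ E) (y : E), y ∈ X ∧ f (y - o) = 1 ∧ (∀ z ∈ X, f (z - o) ≤ 1) ∧
      x ∈ segment ℝ o y := by
  set v := x - o with hv
  have hv0 : v ≠ 0 := sub_ne_zero.mpr hxo
  have hcont : Continuous fun t : ℝ => o + t • v := by fun_prop
  have hT : IsCompact ((fun t : ℝ => o + t • v) ⁻¹' X) :=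
    (((Homeomorph.addLeft o).isClosedEmbedding).comp
      (isClosedEmbedding_smul_left hv0)).isCompact_preimage hXk
  obtain ⟨t, ht, htmax⟩ := hT.exists_isGreatest ⟨1, by simp [hv, hx]⟩
  have ht1 : 1 ≤ t := htmax (by simp [hv, hx])
  have hyX : o + t • v ∈ X := ht
  have hyint : o + t • v ∉ interior X := by
    intro hy
    have hnhds : (fun t : ℝ => o + t • v) ⁻¹' X ∈ nhds t :=
      hcont.continuousAt.preimage_mem_nhds (mem_interior_iff_mem_nhds.mp hy)
    obtain ⟨s, hs, hts⟩ := (Filter.nonempty_of_mem (Filter.inter_mem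
      (nhdsWithin_le_nhds (s := Set.Ioi t) hnhds) self_mem_nhdsWithin))
    exact absurd (htmax hs) (not_le.mpr hts)
  obtain ⟨f, hf⟩ := geometric_hahn_banach_open_point hXc.interior isOpen_interior hyint
  have hfX : ∀ z ∈ X, f z ≤ f (o + t • v) := by
    intro z hz
    have hcl : closure (interior X) ⊆ f ⁻¹' Set.Iic (f (o + t • v)) :=
      closure_minimal (fun w hw => (hf w hw).le) (isClosed_Iic.preimage f.continuous)
    refine hcl ?_
    rw [hXc.closure_interior_eq_closure_of_nonempty_interior ⟨o, ho⟩]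
    exact subset_closure hz
  have hpos : 0 < f (o + t • v) - f o := sub_pos.mpr (hf o ho)
  refine ⟨(f (o + t • v) - f o)⁻¹ • f, o + t • v, hyX, ?_, ?_, ?_⟩
  · rw [smul_apply, map_sub, smul_eq_mul, inv_mul_cancel₀ hpos.ne']
  · intro z hz
    rw [smul_apply, map_sub, smul_eq_mul, inv_mul_le_one₀ hpos]
    linarith [hfX z hz]
  · rw [segment_eq_image']
    refine ⟨t⁻¹, ⟨by positivity, inv_le_one_of_one_le₀ ht1⟩, ?_⟩
    have : t ≠ 0 := by positivity
    simp [smul_smul, this, hv]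

theorem le_of_mem_convexHull_insert {X F : Set E} {o x : E} {f g : StrongDual ℝ E} (hFX : F ⊆ X)
    (hf : ∀ y ∈ F, f (y - o) = 1) (hg : ∀ y ∈ X, g (y - o) ≤ 1)
    (hx : x ∈ convexHull ℝ (insert o F)) : g (x - o) ≤ f (x - o) := by
  have hconv : Convex ℝ {x | (g - f) (x - o) ≤ 0} := by
    have : {x | (g - f) (x - o) ≤ 0} = {x | (g - f) x ≤ (g - f) o} := by
      ext z; simp only [map_sub, Set.mem_ofPred_eq, sub_nonpos]
    rw [this]
    exact convex_halfSpace_le (g - f).toLinearMap.isLinear _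
  have h : insert o F ⊆ {x | (g - f) (x - o) ≤ 0} := by
    rintro z (rfl | hz)
    · simp
    · have h1 := hg z (hFX hz)
      have h2 := hf z hz
      change g (z - o) - f (z - o) ≤ 0
      linarith
  simpa using convexHull_min h hconv hx

/-- The cone over a simplicial facet is a full-dimensional simplex. -/
theorem IsFacet.exists_affineBasis [FiniteDimensional ℝ E] {X F : Set E} {o : E} (hXc : Convex ℝ X)
    (ho : o ∈ interior X) (hF : IsFacet X F) (hFs : IsGeomSimplex F) {n : ℕ}
    (hn : Module.finrank ℝ E = n) :
    ∃ b : AffineBasis (Fin (n + 1)) ℝ E,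
      convexHull ℝ (Set.range b) = convexHull ℝ (insert o F) := by
  obtain ⟨W, hWne, hWind, hWF⟩ := hFs
  obtain ⟨f, hFf, hf⟩ := hF.exists_functional ho
  have hWf : ∀ w ∈ W, f w = f o + 1 := by
    intro w hw
    have : w ∈ F := by rw [hWF]; exact subset_convexHull ℝ _ hw
    rw [hFf] at this
    have := this.2
    rw [map_sub] at this
    linarith
  have htop : vectorSpan ℝ X = ⊤ := by
    rw [← direction_affineSpan,
      (hXc.interior_nonempty_iff_affineSpan_eq_top).mp ⟨o, ho⟩, AffineSubspace.direction_top]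
  have hcard : Fintype.card W = n := by
    have : Nonempty W := hWne.to_subtype
    have h1 := hWind.finrank_vectorSpan_add_one
    have h2 : vectorSpan ℝ (Set.range fun v : W => (v : E)) = vectorSpan ℝ F := by
      rw [hWF, ← direction_affineSpan, ← direction_affineSpan, affineSpan_convexHull]
      simp
    rw [h2, hF.2.2, htop, finrank_top, hn] at h1
    exact h1.symm
  let p : Option W → E := fun w => w.elim o fun v => (v : E)
  have hp : AffineIndependent ℝ p := by
    refine AffineIndependent.affineIndependent_of_notMem_span (i := none) ?_ ?_
    · let e : {y : Option W // y ≠ none} ↪ W :=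
        ⟨fun y => y.1.get (Option.isSome_iff_ne_none.mpr y.2), by
          rintro ⟨_ | a, ha⟩ ⟨_ | b, hb⟩ h
          · exact absurd rfl ha
          · exact absurd rfl ha
          · exact absurd rfl hb
          · exact Subtype.ext (congrArg some h)⟩
      have he : (fun x : {y : Option W // y ≠ none} => p x) = (fun v : W => (v : E)) ∘ e := by
        funext x
        obtain ⟨_ | a, ha⟩ := x
        · exact absurd rfl ha
        · rfl
      rw [he]
      exact hWind.comp_embedding e
    · intro hmem
      have := eq_of_mem_affineSpan (f := f) (c := f o + 1) ?_ hmem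
      · change f o = f o + 1 at this
        linarith
      · rintro _ ⟨_ | w, hw, rfl⟩
        · exact absurd rfl hw
        · exact hWf w w.2
  have hpcard : Fintype.card (Option W) = n + 1 := by rw [Fintype.card_option, hcard]
  let b : AffineBasis (Option W) ℝ E := ⟨p, hp,
    hp.affineSpan_eq_top_iff_card_eq_finrank_add_one.mpr (by rw [hpcard, hn])⟩
  refine ⟨b.reindex (Fintype.equivFinOfCardEq hpcard), ?_⟩
  have hrange : Set.range b = insert o (W : Set E) := by
    ext z
    constructor
    · rintro ⟨_ | w, rfl⟩
      · exact Or.inl rfl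
      · exact Or.inr w.2
    · rintro (rfl | hz)
      · exact ⟨none, rfl⟩
      · exact ⟨some ⟨z, hz⟩, rfl⟩
  rw [AffineBasis.coe_reindex, Set.range_comp, Equiv.range_eq_univ, Set.image_univ, hrange, hWF]
  refine le_antisymm (convexHull_mono (Set.insert_subset_insert (subset_convexHull ℝ _))) ?_
  refine convexHull_min (Set.insert_subset (subset_convexHull ℝ _ (Set.mem_insert _ _))
    (convexHull_mono (Set.subset_insert _ _))) (convex_convexHull ℝ _)

variable [FiniteDimensional ℝ E] [MeasurableSpace E] [BorelSpace E]
  (μ : Measure E) [μ.IsAddHaarMeasure]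

/-- On the cone over a facet its normalized functional dominates that of any other facet. On the
common part of two cones the two functionals agree, so this part lies in a hyperplane. -/
theorem measure_convexHull_insert_inter_facets {X F F' : Set E} {o : E}
    (ho : o ∈ interior X) (hF : IsFacet X F) (hF' : IsFacet X F') (hne : F ≠ F') :
    μ (convexHull ℝ (insert o F) ∩ convexHull ℝ (insert o F')) = 0 := by
  obtain ⟨f, hFf, hf⟩ := hF.exists_functional ho
  obtain ⟨f', hFf', hf'⟩ := hF'.exists_functional ho
  have hsub : convexHull ℝ (insert o F) ∩ convexHull ℝ (insert o F') ⊆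
      (fun x => x + (-o)) ⁻¹' ((f - f').toLinearMap.ker : Set E) := by
    rintro x ⟨hx, hx'⟩
    have h1 := le_of_mem_convexHull_insert hF.2.1.subset
      (fun y hy => by rw [hFf] at hy; exact hy.2) hf' hx
    have h2 := le_of_mem_convexHull_insert hF'.2.1.subset
      (fun y hy => by rw [hFf'] at hy; exact hy.2) hf hx'
    have h3 : f (x - o) - f' (x - o) = 0 := by linarith
    simpa [← sub_eq_add_neg] using h3
  refine measure_mono_null hsub ?_
  rw [measure_preimage_add_right]
  refine Measure.addHaar_submodule μ _ fun htop => hne ?_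
  have heq : f = f' := by
    rw [LinearMap.ker_eq_top] at htop
    ext z
    have := LinearMap.congr_fun htop z
    simpa [sub_eq_zero] using this
  rw [hFf, hFf', heq]

/-- A point outside the cones over facets lies in the cone over a lower-dimensional exposed face.
There are finitely many of these, each with its cone in a proper affine subspace. -/
theorem measure_diff_iUnion_convexHull_insert_facets {X : Set E} {o : E}
    (hX : IsConvexPolytope X) (hd : 0 < Module.finrank ℝ E) (ho : o ∈ interior X) :
    μ (X \ ⋃ F ∈ {F : Set E | IsFacet X F}, convexHull ℝ (insert o F)) = 0 := by
  have : Nontrivial E := Module.finrank_pos_iff.mp hd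
  have htop : vectorSpan ℝ X = ⊤ := by
    rw [← direction_affineSpan,
      (hX.convex.interior_nonempty_iff_affineSpan_eq_top).mp ⟨o, ho⟩, AffineSubspace.direction_top]
  set S := {G : Set E | IsExposed ℝ X G ∧
    Module.finrank ℝ (vectorSpan ℝ G) + 1 < Module.finrank ℝ E} with hS
  have hSfin : S.Finite := hX.finite_isExposed.subset fun G hG => hG.1
  have hnull : μ ({o} ∪ ⋃ G ∈ S, (affineSpan ℝ (insert o G) : Set E)) = 0 := by
    refine measure_union_null (measure_singleton o)
      ((measure_biUnion_null_iff hSfin.countable).mpr fun G hG => ?_)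
    refine Measure.addHaar_affineSubspace μ _ fun h => ?_
    have h1 := finrank_vectorSpan_insert_le_set ℝ G o
    rw [← direction_affineSpan, h, AffineSubspace.direction_top, finrank_top] at h1
    exact absurd hG.2 (not_lt.mpr h1)
  refine measure_mono_null ?_ hnull
  rintro x ⟨hxX, hxU⟩
  by_cases hxo : x = o
  · exact Or.inl hxo
  right
  obtain ⟨f, y, hyX, hfy, hf, hxy⟩ :=
    exists_supporting_functional hX.convex hX.isCompact ho hxX hxo
  set G := {z ∈ X | f (z - o) = 1} with hG
  have hyG : y ∈ G := ⟨hyX, hfy⟩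
  have hexp : IsExposed ℝ X G := by
    intro _
    refine ⟨f, ?_⟩
    ext z
    refine and_congr_right fun hz => ?_
    have h1 := hf z hz
    simp only [map_sub] at h1 hfy ⊢
    constructor
    · intro h w hw
      have h2 := hf w hw
      rw [map_sub] at h2
      linarith
    · intro h
      linarith [h y hyX]
  have hxcone : x ∈ convexHull ℝ (insert o G) :=
    segment_subset_convexHull (Set.mem_insert _ _) (Set.mem_insert_of_mem _ hyG) hxy
  have hle : Module.finrank ℝ (vectorSpan ℝ G) < Module.finrank ℝ E := by
    have hker : vectorSpan ℝ G ≤ f.toLinearMap.ker := by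
      rw [vectorSpan, Submodule.span_le]
      rintro _ ⟨a, ha, b, hb, rfl⟩
      have h1 := ha.2
      have h2 := hb.2
      rw [map_sub] at h1 h2
      simp only [vsub_eq_sub, SetLike.mem_coe, LinearMap.mem_ker, map_sub]
      change f a - f b = 0
      linarith
    refine Submodule.finrank_lt fun h => ?_
    rw [h, top_le_iff, LinearMap.ker_eq_top] at hker
    have : f (y - o) = 0 := LinearMap.congr_fun hker (y - o)
    linarith
  refine Set.mem_biUnion (x := G) ⟨hexp, lt_of_le_of_ne hle fun heq => hxU ?_⟩
    (convexHull_subset_affineSpan _ hxcone)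
  refine Set.mem_biUnion (x := G) ⟨⟨y, hyG⟩, hexp, ?_⟩ hxcone
  rw [htop, finrank_top, heq]

end

/-! ### The part of the body missed by a random convex hull -/

theorem mem_convexHull_range_iff {κ E : Type*} [Fintype κ] [AddCommGroup E] [Module ℝ E]
    {z : κ → E} {x : E} :
    x ∈ convexHull ℝ (Set.range z) ↔ ∃ w ∈ stdSimplex ℝ κ, ∑ i, w i • z i = x := by
  classical
  have h : convexHull ℝ (Set.range z) =
      (⇑(∑ i : κ, (LinearMap.proj (R := ℝ) (φ := fun _ => ℝ) i).smulRight (z i))) ''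
        stdSimplex ℝ κ := by
    rw [← convexHull_basis_eq_stdSimplex, LinearMap.image_convexHull, ← Set.range_comp]
    congr 2
    ext i
    simp
  rw [h]
  simp [LinearMap.sum_apply]

/-- Joint closedness in the sample and the point, as the projection of a closed set along the
compact simplex of weights. It makes the missed volume measurable and Tonelli applicable. -/
theorem isClosed_setOf_mem_convexHull_range {κ E : Type*} [Fintype κ] [NormedAddCommGroup E]
    [NormedSpace ℝ E] :
    IsClosed {p : (κ → E) × E | p.2 ∈ convexHull ℝ (Set.range p.1)} := by
  have : CompactSpace (stdSimplex ℝ κ) :=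
    isCompact_iff_compactSpace.mp (isCompact_stdSimplex ℝ κ)
  have h : {p : (κ → E) × E | p.2 ∈ convexHull ℝ (Set.range p.1)} =
      Prod.fst '' {r : ((κ → E) × E) × stdSimplex ℝ κ |
        ∑ i, (r.2 : κ → ℝ) i • r.1.1 i = r.1.2} := by
    ext p
    simp only [Set.mem_ofPred_eq, mem_convexHull_range_iff]
    constructor
    · rintro ⟨w, hw, h⟩
      exact ⟨(p, ⟨w, hw⟩), h, rfl⟩
    · rintro ⟨r, hr, rfl⟩
      exact ⟨r.2, r.2.2, hr⟩
  rw [h]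
  exact isClosedMap_fst_of_compactSpace _ (isClosed_eq
    (continuous_finsetSum _ fun i _ =>
      ((continuous_apply i).comp (continuous_subtype_val.comp continuous_snd)).smul
        ((continuous_apply i).comp (continuous_fst.comp continuous_fst)))
    (continuous_snd.comp continuous_fst))

theorem sampleHull_eq_convexHull_range {Ω E : Type*} [AddCommGroup E] [Module ℝ E]
    (q : ℕ → Ω → E) (N : ℕ) (ω : Ω) :
    sampleHull q N ω = convexHull ℝ (Set.range fun i : Fin N => q i ω) := by
  unfold sampleHull
  congr 1
  ext x
  constructor
  · rintro ⟨i, hi, rfl⟩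
    exact ⟨⟨i, hi⟩, rfl⟩
  · rintro ⟨i, rfl⟩
    exact ⟨i, i.2, rfl⟩

/-- The pairs of a sample and a point of `X` that the convex hull of the sample misses. -/
def missedPairs {E : Type*} [AddCommGroup E] [Module ℝ E] (X : Set E) (N : ℕ) :
    Set ((Fin N → E) × E) :=
  {p | p.2 ∈ X ∧ p.2 ∉ convexHull ℝ (Set.range p.1)}

theorem mk_preimage_missedPairs {Ω E : Type*} [AddCommGroup E] [Module ℝ E]
    (q : ℕ → Ω → E) (X : Set E) (N : ℕ) (ω : Ω) :
    Prod.mk (fun i : Fin N => q i ω) ⁻¹' missedPairs X N = X \ sampleHull q N ω := by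
  rw [sampleHull_eq_convexHull_range]
  rfl

theorem measurableSet_sampleHull {Ω E : Type*} [NormedAddCommGroup E] [NormedSpace ℝ E]
    [MeasurableSpace E] [BorelSpace E] (q : ℕ → Ω → E) (N : ℕ) (ω : Ω) :
    MeasurableSet (sampleHull q N ω) :=
  ((((Set.finite_Iio N).image _).isCompact_convexHull (𝕜 := ℝ)).isClosed).measurableSet

theorem ae_sampleHull_subset {Ω E : Type*} [MeasurableSpace Ω] {P : Measure Ω}
    [AddCommGroup E] [Module ℝ E] [MeasurableSpace E] {μ : Measure E} {q : ℕ → Ω → E}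
    {X : Set E} {N : ℕ} (hXc : Convex ℝ X) (hXm : MeasurableSet X)
    (hX0 : μ X ≠ 0) (hX1 : μ X ≠ ⊤) (hq : ∀ i, pdf.IsUniform (q i) X P μ) :
    ∀ᵐ ω ∂P, sampleHull q N ω ⊆ X := by
  have h1 : ∀ᵐ ω ∂P, ∀ i, q i ω ∈ X := by
    rw [ae_all_iff]
    intro i
    have h := (hq i).measure_preimage hX0 hX1 hXm.compl
    rw [Set.inter_compl_self, measure_empty, ENNReal.zero_div] at h
    exact measure_eq_zero_iff_ae_notMem.mp h |>.mono fun ω hω => not_not.mp hω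
  filter_upwards [h1] with ω hω
  refine convexHull_min ?_ hXc
  rintro _ ⟨i, -, rfl⟩
  exact hω i

/-- A sample of `N` points fails to hit all of finitely many sets of relative volume at least `p`
with probability at most `card ι * exp (-p N)`. -/
theorem prob_exists_forall_notMem_le {Ω E ι : Type*} [Fintype ι] [MeasurableSpace Ω]
    {P : Measure Ω} [IsProbabilityMeasure P] [MeasurableSpace E] {μ : Measure E}
    {q : ℕ → Ω → E} {X : Set E} {N : ℕ} (hind : iIndepFun q P)
    (hX0 : μ X ≠ 0) (hX1 : μ X ≠ ⊤) (hq : ∀ i, pdf.IsUniform (q i) X P μ) {A : ι → Set E}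
    (hA : ∀ i, MeasurableSet (A i)) (hAX : ∀ i, A i ⊆ X) {p : ℝ}
    (hp : ∀ i, ENNReal.ofReal p * μ X ≤ μ (A i)) :
    P {ω | ∃ i, ∀ k < N, q k ω ∉ A i}
      ≤ Fintype.card ι * ENNReal.ofReal (Real.exp (-(p * N))) := by
  have hk : ∀ i k, P (q k ⁻¹' (A i)ᶜ) ≤ ENNReal.ofReal (Real.exp (-p)) := by
    intro i k
    have hm := (hq k).aemeasurable hX0 hX1
    have h1 : ENNReal.ofReal p ≤ P (q k ⁻¹' A i) := by
      rw [(hq k).measure_preimage hX0 hX1 (hA i), Set.inter_eq_right.mpr (hAX i)]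
      exact (ENNReal.le_div_iff_mul_le (Or.inl hX0) (Or.inl hX1)).mpr (hp i)
    rw [Set.preimage_compl, prob_compl_eq_one_sub₀ (hm.nullMeasurableSet_preimage (hA i))]
    calc 1 - P (q k ⁻¹' A i) ≤ ENNReal.ofReal 1 - ENNReal.ofReal p := by
          rw [ENNReal.ofReal_one]; gcongr
      _ ≤ ENNReal.ofReal (1 - p) := by
          by_cases h : 0 ≤ p
          · rw [ENNReal.ofReal_sub _ h]
          · rw [ENNReal.ofReal_of_nonpos (not_le.mp h).le, tsub_zero]
            exact ENNReal.ofReal_le_ofReal (by linarith)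
      _ ≤ _ := ENNReal.ofReal_le_ofReal (Real.one_sub_le_exp_neg p)
  have hi : ∀ i, P {ω | ∀ k < N, q k ω ∉ A i} ≤ ENNReal.ofReal (Real.exp (-(p * N))) := by
    intro i
    have h1 : {ω | ∀ k < N, q k ω ∉ A i} = ⋂ k ∈ Finset.range N, q k ⁻¹' (A i)ᶜ := by
      ext ω; simp
    rw [h1, hind.measure_inter_preimage_eq_mul _ fun k _ => (hA i).compl]
    calc ∏ k ∈ Finset.range N, P (q k ⁻¹' (A i)ᶜ)
        ≤ ∏ _k ∈ Finset.range N, ENNReal.ofReal (Real.exp (-p)) :=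
          Finset.prod_le_prod' fun k _ => hk i k
      _ = _ := by
          rw [Finset.prod_const, Finset.card_range, ← ENNReal.ofReal_pow (Real.exp_pos _).le,
            ← Real.exp_nat_mul]
          congr 2
          ring
  have hU : {ω | ∃ i, ∀ k < N, q k ω ∉ A i} = ⋃ i, {ω | ∀ k < N, q k ω ∉ A i} := by
    ext ω; simp
  rw [hU]
  refine (measure_iUnion_fintype_le _ _).trans ((Finset.sum_le_sum fun i _ => hi i).trans ?_)
  simp

section

variable {Ω E : Type*} [MeasurableSpace Ω] {P : Measure Ω}
  [NormedAddCommGroup E] [NormedSpace ℝ E] [SecondCountableTopology E] [MeasurableSpace E]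
  [BorelSpace E] {μ : Measure E} [SFinite μ]
  {q : ℕ → Ω → E} {X : Set E} {N : ℕ}

theorem measurableSet_missedPairs (hX : MeasurableSet X) :
    MeasurableSet (missedPairs X N) :=
  (measurable_snd hX).inter isClosed_setOf_mem_convexHull_range.measurableSet.compl

theorem aemeasurable_measure_diff_sampleHull (hq : ∀ i, AEMeasurable (q i) P)
    (hX : MeasurableSet X) : AEMeasurable (fun ω => μ (X \ sampleHull q N ω)) P := by
  have hZ : AEMeasurable (fun ω (i : Fin N) => q i ω) P := aemeasurable_pi_lambda _ fun i => hq i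
  have h := (measurable_measure_prodMk_left (ν := μ)
    (measurableSet_missedPairs (N := N) hX)).comp_aemeasurable hZ
  refine h.congr (Filter.Eventually.of_forall fun ω => ?_)
  exact congrArg μ (mk_preimage_missedPairs q X N ω)

variable [IsProbabilityMeasure P]

theorem lintegral_measure_diff_sampleHull (hq : ∀ i, AEMeasurable (q i) P)
    (hX : MeasurableSet X) :
    ∫⁻ ω, μ (X \ sampleHull q N ω) ∂P = ∫⁻ x in X, P {ω | x ∉ sampleHull q N ω} ∂μ := by
  have hZ : AEMeasurable (fun ω (i : Fin N) => q i ω) P := aemeasurable_pi_lambda _ fun i => hq i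
  have hM := measurableSet_missedPairs (N := N) hX
  set ν := P.map fun ω (i : Fin N) => q i ω with hν
  have : IsProbabilityMeasure ν := Measure.isProbabilityMeasure_map hZ
  have h1 : ∫⁻ ω, μ (X \ sampleHull q N ω) ∂P = (ν.prod μ) (missedPairs X N) := by
    rw [Measure.prod_apply hM, hν,
      lintegral_map' (measurable_measure_prodMk_left hM).aemeasurable hZ]
    exact lintegral_congr fun ω => (congrArg μ (mk_preimage_missedPairs q X N ω)).symm
  rw [h1, Measure.prod_apply_symm hM, ← lintegral_indicator hX]
  refine lintegral_congr fun x => ?_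
  by_cases hx : x ∈ X
  · rw [Set.indicator_of_mem hx, hν,
      Measure.map_apply_of_aemeasurable hZ (measurable_prodMk_right hM)]
    congr 1
    ext ω
    have h2 : (fun i : Fin N => q i ω, x) ∈ missedPairs X N ↔ x ∈ X \ sampleHull q N ω := by
      rw [← mk_preimage_missedPairs]; rfl
    exact h2.trans ⟨fun h => h.2, fun h => ⟨hx, h⟩⟩
  · rw [Set.indicator_of_notMem hx]
    have h2 : (fun z : Fin N → E => (z, x)) ⁻¹' missedPairs X N = ∅ := by
      ext z
      simp [missedPairs, hx]
    rw [h2, measure_empty]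

/-- Points outside `B` are missed with probability at most `δ`; those in `B` are given up. -/
theorem lintegral_measure_diff_sampleHull_le (hq : ∀ i, AEMeasurable (q i) P)
    (hX : MeasurableSet X) {B : Set E} {δ : ENNReal}
    (hδ : ∀ x ∈ X \ B, P {ω | x ∉ sampleHull q N ω} ≤ δ) :
    ∫⁻ ω, μ (X \ sampleHull q N ω) ∂P ≤ δ * μ X + μ B := by
  rw [lintegral_measure_diff_sampleHull hq hX]
  have hB := measurableSet_toMeasurable μ B
  calc ∫⁻ x in X, P {ω | x ∉ sampleHull q N ω} ∂μ
      ≤ ∫⁻ x in X, (δ + (toMeasurable μ B).indicator 1 x) ∂μ := by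
        refine setLIntegral_mono' hX fun x hx => ?_
        by_cases hxB : x ∈ B
        · rw [Set.indicator_of_mem (subset_toMeasurable μ B hxB)]
          exact prob_le_one.trans le_add_self
        · exact (hδ x ⟨hx, hxB⟩).trans le_self_add
    _ ≤ δ * μ X + μ B := by
        rw [lintegral_add_left measurable_const, lintegral_const, Measure.restrict_apply_univ,
          lintegral_indicator_one hB, ← measure_toMeasurable B]
        gcongr
        exact Measure.restrict_le_self

/-- An expected missed fraction of at most `ε ^ 2` bounds both the expected volume and, by Markov's
inequality, the probability of missing a fraction `ε`. -/
theorem volume_sampleHull_bounds (hXc : Convex ℝ X) (hXm : MeasurableSet X)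
    (hX0 : μ X ≠ 0) (hX1 : μ X ≠ ⊤) (hq : ∀ i, pdf.IsUniform (q i) X P μ) {ε : ℝ} (hε : 0 < ε)
    (hε1 : ε ≤ 1)
    (h : ∫⁻ ω, μ (X \ sampleHull q N ω) ∂P ≤ ENNReal.ofReal (ε ^ 2) * μ X) :
    (1 - ε) * μ.real X ≤ ∫ ω, μ.real (sampleHull q N ω) ∂P ∧
      1 - ε ≤ P.real {ω | (1 - ε) * μ.real X ≤ μ.real (sampleHull q N ω)} := by
  have hqm : ∀ i, AEMeasurable (q i) P := fun i => (hq i).aemeasurable hX0 hX1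
  have hXpos : 0 < μ.real X := ENNReal.toReal_pos hX0 hX1
  have hfin : ∀ ω, μ (X \ sampleHull q N ω) < ⊤ := fun ω =>
    (measure_mono Set.sdiff_subset).trans_lt hX1.lt_top
  set g : Ω → ℝ := fun ω => μ.real (X \ sampleHull q N ω) with hg
  have hgm : AEMeasurable g P := (aemeasurable_measure_diff_sampleHull hqm hXm).ennreal_toReal
  have hg0 : ∀ ω, 0 ≤ g ω := fun ω => measureReal_nonneg
  have hgX : ∀ ω, g ω ≤ μ.real X := fun ω =>
    ENNReal.toReal_mono hX1 (measure_mono Set.sdiff_subset)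
  have hgi : Integrable g P := by
    refine Integrable.of_bound hgm.aestronglyMeasurable (μ.real X)
      (Filter.Eventually.of_forall fun ω => ?_)
    rw [Real.norm_of_nonneg (hg0 ω)]
    exact hgX ω
  have hgint : ∫ ω, g ω ∂P ≤ ε ^ 2 * μ.real X := by
    have h1 : ∫ ω, g ω ∂P = (∫⁻ ω, μ (X \ sampleHull q N ω) ∂P).toReal :=
      integral_toReal (aemeasurable_measure_diff_sampleHull hqm hXm)
        (Filter.Eventually.of_forall hfin)
    rw [h1]
    refine (ENNReal.toReal_mono (ENNReal.mul_ne_top ENNReal.ofReal_ne_top hX1) h).trans_eq ?_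
    rw [ENNReal.toReal_mul, ENNReal.toReal_ofReal (by positivity)]
    rfl
  have hae : ∀ᵐ ω ∂P, μ.real (sampleHull q N ω) = μ.real X - g ω := by
    filter_upwards [ae_sampleHull_subset (N := N) hXc hXm hX0 hX1 hq] with ω hω
    have := measureReal_sdiff_add_inter (μ := μ) (s := X) (measurableSet_sampleHull q N ω) hX1
    rw [Set.inter_eq_right.mpr hω] at this
    simp only [hg]
    linarith
  constructor
  · rw [integral_congr_ae hae, integral_sub (integrable_const _) hgi]
    simp only [integral_const, probReal_univ, one_smul]
    nlinarith [mul_le_mul_of_nonneg_right (show ε ^ 2 ≤ ε by nlinarith) hXpos.le]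
  · have hmarkov := mul_meas_ge_le_integral_of_nonneg
      (Filter.Eventually.of_forall hg0) hgi (ε * μ.real X)
    have h2 : P.real {ω | ε * μ.real X ≤ g ω} ≤ ε := by
      have h3 : (ε * μ.real X) * P.real {ω | ε * μ.real X ≤ g ω} ≤ (ε * μ.real X) * ε := by
        refine hmarkov.trans (hgint.trans_eq (by ring))
      exact le_of_mul_le_mul_left h3 (by positivity)
    have h4 : (1 : ℝ) ≤ P.real {ω | ε * μ.real X ≤ g ω} +
        P.real {ω | (1 - ε) * μ.real X ≤ μ.real (sampleHull q N ω)} := by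
      refine le_trans ?_ (measureReal_union_le _ _)
      refine (probReal_univ (μ := P)).symm.trans_le ?_
      refine ENNReal.toReal_mono (measure_ne_top _ _) (measure_mono_ae ?_)
      filter_upwards [hae] with ω hω _
      by_cases hc : ε * μ.real X ≤ g ω
      · exact Or.inl hc
      · right
        change (1 - ε) * μ.real X ≤ μ.real (sampleHull q N ω)
        rw [hω]
        linarith [not_le.mp hc]
    linarith

end

/-! ### Simplicial polytopes -/

section

variable {Ω E : Type*} [MeasurableSpace Ω] {P : Measure Ω} [IsProbabilityMeasure P]
  [NormedAddCommGroup E] [NormedSpace ℝ E] [FiniteDimensional ℝ E] [MeasurableSpace E]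
  [BorelSpace E] {μ : Measure E} [μ.IsAddHaarMeasure]
  {q : ℕ → Ω → E} {X : Set E} {N : ℕ}

/-- A point `x` of a simplex in `X` whose coordinate products are not too small is rarely missed:
its corner regions each have relative volume at least `(r / e) ^ n * v` in `X`. -/
theorem prob_notMem_sampleHull_le {ι : Type*} [Fintype ι] [DecidableEq ι]
    (hind : iIndepFun q P) (hX0 : μ X ≠ 0) (hX1 : μ X ≠ ⊤)
    (hq : ∀ i, pdf.IsUniform (q i) X P μ) (b : AffineBasis ι ℝ E) {n : ℕ}
    (hn : Fintype.card ι = n + 1) (hn0 : 0 < n) (hbX : convexHull ℝ (Set.range b) ⊆ X)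
    {r v : ℝ} (hr : 0 < r)
    (hv : ENNReal.ofReal v * μ X ≤ μ (convexHull ℝ (Set.range b))) {x : E}
    (hx : x ∈ convexHull ℝ (Set.range b))
    (hxr : ∀ i : ι, (r / n) ^ n ≤ ∏ j : {j // j ≠ i}, b.coord j x) :
    P {ω | x ∉ sampleHull q N ω}
      ≤ (n + 1) * ENNReal.ofReal (Real.exp (-((r / Real.exp 1) ^ n * v * N))) := by
  have hsub : {ω | x ∉ sampleHull q N ω} ⊆ {ω | ∃ i, ∀ k < N, q k ω ∉ cornerRegion b i x} := by
    intro ω hω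
    by_contra hcon
    simp only [Set.mem_ofPred_eq, not_exists, not_forall, not_not] at hcon
    refine hω (mem_convexHull_of_coord_le b ((Set.finite_Iio N).image _) fun i => ?_)
    obtain ⟨k, hk, hki⟩ := hcon i
    exact ⟨q k ω, ⟨k, hk, rfl⟩, hki.2⟩
  refine (measure_mono hsub).trans ((prob_exists_forall_notMem_le (μ := μ)
    (p := (r / Real.exp 1) ^ n * v) hind hX0 hX1 hq
    (fun i => measurableSet_cornerRegion b i hx) (fun i a ha => hbX ha.1) fun i => ?_).trans_eq ?_)
  · rw [ENNReal.ofReal_mul (by positivity), mul_assoc]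
    exact (mul_le_mul_right hv _).trans (le_measure_cornerRegion μ b hn hn0 hr i hx (hxr i))
  · rw [hn]; norm_cast

/-- The expected missed volume. The three contributions are the cones that are too small, the points
near the walls of their cone, and the remaining points that are missed by chance. -/
theorem lintegral_measure_diff_sampleHull_le_of_isSimplicialPolytope
    (hX : IsSimplicialPolytope X) {o : E} (ho : o ∈ interior X) {n m : ℕ}
    (hn : Module.finrank ℝ E = n) (hn0 : 0 < n)
    (hm : {F : Set E | IsFacet X F}.encard = m)
    (hind : iIndepFun q P) (hq : ∀ i, pdf.IsUniform (q i) X P μ)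
    (hN : Real.exp 12 ^ n * m < N) :
    ∫⁻ ω, μ (X \ sampleHull q N ω) ∂P
      ≤ ENNReal.ofReal ((2 * n + 3) * Real.exp (-(2 * n))) * μ X := by
  have hXc := hX.1.convex
  have hXk := hX.1.isCompact
  have hXm := hXk.isClosed.measurableSet
  have hX0 : μ X ≠ 0 := (Measure.measure_pos_of_nonempty_interior μ ⟨o, ho⟩).ne'
  have hX1 : μ X ≠ ⊤ := hXk.measure_ne_top
  have hfin : {F : Set E | IsFacet X F}.Finite := Set.finite_of_encard_eq_coe hm
  set 𝓕 := hfin.toFinset with h𝓕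
  have hmem : ∀ F, F ∈ 𝓕 ↔ IsFacet X F := fun F => by simp [h𝓕]
  have hcard : 𝓕.card = m := by
    rw [hfin.encard_eq_coe_toFinset_card] at hm
    exact_mod_cast hm
  have hcoveX : ∀ F ∈ 𝓕, convexHull ℝ (insert o F) ⊆ X := fun F hF =>
    convexHull_min (Set.insert_subset (interior_subset ho) ((hmem F).mp hF).2.1.subset) hXc
  have hconem : ∀ F ∈ 𝓕, MeasurableSet (convexHull ℝ (insert o F)) := by
    intro F hF
    obtain ⟨b, hb⟩ := ((hmem F).mp hF).exists_affineBasis hXc ho (hX.2 F ((hmem F).mp hF)) hn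
    rw [← hb]
    exact (((Set.finite_range b).isCompact_convexHull (𝕜 := ℝ)).isClosed).measurableSet
  have hsum : ∑ F ∈ 𝓕, μ (convexHull ℝ (insert o F)) ≤ μ X := by
    rw [← measure_biUnion_finset₀ ?_ fun F hF => (hconem F hF).nullMeasurableSet]
    · exact measure_mono (Set.iUnion₂_subset hcoveX)
    · intro F hF F' hF' hne
      exact measure_convexHull_insert_inter_facets μ ho ((hmem F).mp hF) ((hmem F').mp hF') hne
  set δ : ENNReal := ENNReal.ofReal (Real.exp (-(2 * n))) with hδ
  set v : ℝ := Real.exp (-(2 * n)) / m with hv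
  have hn1 : (0 : ℝ) < n := by exact_mod_cast hn0
  have hpow : (Real.exp 1 * √Real.pi * √(Real.exp (-8))) ^ n ≤ Real.exp (-(2 * n)) := by
    have h1 : √Real.pi ≤ Real.exp 1 := by
      refine Real.sqrt_le_iff.mpr ⟨(Real.exp_pos 1).le, ?_⟩
      nlinarith [Real.pi_le_four, Real.add_one_le_exp (1 : ℝ)]
    have h2 : √(Real.exp (-8)) = Real.exp (-4) := by
      rw [← Real.exp_half]; norm_num
    calc (Real.exp 1 * √Real.pi * √(Real.exp (-8))) ^ n
        ≤ (Real.exp 1 * Real.exp 1 * Real.exp (-4)) ^ n := by rw [h2]; gcongr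
      _ = Real.exp (-(2 * n)) := by
          rw [← Real.exp_add, ← Real.exp_add, ← Real.exp_nat_mul]
          congr 1
          ring
  have hbad : ∀ F ∈ 𝓕, ∃ B : Set E, μ B ≤ (n + 1) * (δ * μ (convexHull ℝ (insert o F))) ∧
      (ENNReal.ofReal v * μ X ≤ μ (convexHull ℝ (insert o F)) →
        ∀ x ∈ convexHull ℝ (insert o F) \ B, P {ω | x ∉ sampleHull q N ω} ≤ (n + 1) * δ) := by
    intro F hF
    obtain ⟨b, hb⟩ := ((hmem F).mp hF).exists_affineBasis hXc ho (hX.2 F ((hmem F).mp hF)) hn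
    have hc : Fintype.card (Fin (n + 1)) = n + 1 := Fintype.card_fin _
    have hmpos : (0 : ℝ) < m := by
      rw [← hcard]; exact_mod_cast Finset.card_pos.mpr ⟨F, hF⟩
    rw [← hb]
    refine ⟨_, (measure_exists_prod_coord_ne_lt_le μ b hc hn0
      (r := Real.exp (-8)) (Real.exp_pos _)).trans ?_, fun hvol x hx => ?_⟩
    · gcongr
      exact ENNReal.ofReal_le_ofReal hpow
    · have hxr : ∀ i : Fin (n + 1),
          (Real.exp (-8) / n) ^ n ≤ ∏ j : {j // j ≠ i}, b.coord j x := by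
        intro i
        by_contra hcon
        exact hx.2 ⟨hx.1, i, not_le.mp hcon⟩
      refine (prob_notMem_sampleHull_le hind hX0 hX1 hq b hc hn0
        (hb.trans_subset (hcoveX F hF)) (Real.exp_pos _) hvol hx.1 hxr).trans ?_
      gcongr
      -- The exponent is at least `exp n`, which exceeds `2 * n`.
      have h1 : (Real.exp (-8) / Real.exp 1) ^ n = Real.exp (-(9 * n)) := by
        rw [← Real.exp_sub, ← Real.exp_nat_mul]
        congr 1
        ring
      have h2 : Real.exp 12 ^ n = Real.exp (12 * n) := by
        rw [← Real.exp_nat_mul]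
        congr 1
        ring
      have h3 : Real.exp n = Real.exp (-(9 * n)) * v * (Real.exp (12 * n) * m) := by
        have : Real.exp n = Real.exp (-(9 * n)) * Real.exp (-(2 * n)) * Real.exp (12 * n) := by
          rw [← Real.exp_add, ← Real.exp_add]
          congr 1
          ring
        rw [this, hv]
        field_simp
      have h4 : 2 * (n : ℝ) ≤ Real.exp n := by
        nlinarith [Real.quadratic_le_exp_of_nonneg hn1.le, sq_nonneg ((n : ℝ) - 1)]
      rw [h2] at hN
      rw [h1]
      refine ENNReal.ofReal_le_ofReal (Real.exp_le_exp.mpr (neg_le_neg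
        (h4.trans (h3.trans_le ?_))))
      gcongr
  choose! B hBμ hBP using hbad
  -- `D` collects everything that is given up: the null set outside the cones, the small cones, and
  -- the exceptional parts of the cones.
  set D : Set E := (X \ ⋃ F ∈ {F : Set E | IsFacet X F}, convexHull ℝ (insert o F)) ∪
    ((⋃ F ∈ 𝓕.filter fun F => μ (convexHull ℝ (insert o F)) < ENNReal.ofReal v * μ X,
      convexHull ℝ (insert o F)) ∪ ⋃ F ∈ 𝓕, B F) with hD
  have hμD : μ D ≤ 0 + (δ * μ X + (n + 1) * (δ * μ X)) := by
    refine (measure_union_le _ _).trans (add_le_add ?_ ((measure_union_le _ _).trans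
      (add_le_add ?_ ?_)))
    · rw [measure_diff_iUnion_convexHull_insert_facets μ hX.1 (hn ▸ hn0) ho]
    · refine (measure_biUnion_finset_le _ _).trans ?_
      calc _ ≤ ∑ _F ∈ 𝓕.filter fun F => μ (convexHull ℝ (insert o F)) < ENNReal.ofReal v * μ X,
            ENNReal.ofReal v * μ X :=
            Finset.sum_le_sum fun F hF => (Finset.mem_filter.mp hF).2.le
        _ ≤ ∑ _F ∈ 𝓕, ENNReal.ofReal v * μ X :=
            Finset.sum_le_sum_of_subset (Finset.filter_subset _ _)
        _ = ENNReal.ofReal (m * v) * μ X := by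
            rw [Finset.sum_const, hcard, nsmul_eq_mul, ENNReal.ofReal_mul (Nat.cast_nonneg _),
              ENNReal.ofReal_natCast, mul_assoc]
        _ ≤ δ * μ X := by
            gcongr
            refine ENNReal.ofReal_le_ofReal ?_
            rw [hv, mul_div_left_comm]
            exact mul_le_of_le_one_right (Real.exp_pos _).le (div_self_le_one _)
    · refine (measure_biUnion_finset_le _ _).trans ((Finset.sum_le_sum hBμ).trans ?_)
      rw [← Finset.mul_sum, ← Finset.mul_sum]
      gcongr
  have hP : ∀ x ∈ X \ D, P {ω | x ∉ sampleHull q N ω} ≤ (n + 1) * δ := by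
    rintro x ⟨hxX, hxD⟩
    simp only [hD, Set.mem_union, not_or] at hxD
    obtain ⟨h1, h2, h3⟩ := hxD
    have hxU : x ∈ ⋃ F ∈ {F : Set E | IsFacet X F}, convexHull ℝ (insert o F) := by
      by_contra hcon
      exact h1 ⟨hxX, hcon⟩
    obtain ⟨F, hF, hxF⟩ := Set.mem_iUnion₂.mp hxU
    have hF' : F ∈ 𝓕 := (hmem F).mpr hF
    refine hBP F hF' (not_lt.mp fun hlt => h2 ?_) x ⟨hxF, fun hxB => h3 ?_⟩
    · exact Set.mem_iUnion₂.mpr ⟨F, Finset.mem_filter.mpr ⟨hF', hlt⟩, hxF⟩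
    · exact Set.mem_iUnion₂.mpr ⟨F, hF', hxB⟩
  refine (lintegral_measure_diff_sampleHull_le (fun i => (hq i).aemeasurable hX0 hX1) hXm hP).trans
    ((add_le_add_right hμD _).trans_eq ?_)
  have hc : ENNReal.ofReal ((2 * n + 3) * Real.exp (-(2 * n))) = (2 * n + 3) * δ := by
    rw [ENNReal.ofReal_mul (by positivity), hδ]
    congr 1
    exact_mod_cast ENNReal.ofReal_natCast (2 * n + 3)
  rw [hc]
  ring

end

theorem theorem1 :
    ∃ c₀ C₀ : ℝ, 0 < c₀ ∧ 0 < C₀ ∧ ∃ d₀ : ℕ, ∀ d : ℕ, d₀ ≤ d →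
      ∀ (X : Set (EuclideanSpace ℝ (Fin d))) (m : ℕ),
        IsSimplicialPolytope X → (interior X).Nonempty →
        {F : Set (EuclideanSpace ℝ (Fin d)) | IsFacet X F}.encard = (m : ℕ∞) →
        ∀ (Ω : Type*) [MeasurableSpace Ω] (P : Measure Ω) [IsProbabilityMeasure P]
          (q : ℕ → Ω → EuclideanSpace ℝ (Fin d)),
          iIndepFun q P → (∀ i, pdf.IsUniform (q i) X P volume) →
          ∀ N : ℕ, C₀ ^ d * (m : ℝ) < (N : ℝ) →
            (1 - Real.exp (-c₀ * √(d : ℝ))) * volume.real X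
                ≤ ∫ ω, volume.real (sampleHull q N ω) ∂P ∧
            1 - Real.exp (-c₀ * √(d : ℝ))
                ≤ P.real {ω | (1 - Real.exp (-c₀ * √(d : ℝ))) * volume.real X
                    ≤ volume.real (sampleHull q N ω)} := by
  refine ⟨1 / 2, Real.exp 12, by norm_num, Real.exp_pos _, 4, ?_⟩
  intro d hd X m hX ⟨o, ho⟩ hm Ω _ P _ q hind hq N hN
  have hXk := hX.1.isCompact
  have hd4 : (4 : ℝ) ≤ d := by exact_mod_cast hd
  have hX0 : volume X ≠ 0 := (Measure.measure_pos_of_nonempty_interior volume ⟨o, ho⟩).ne'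
  refine volume_sampleHull_bounds hX.1.convex hXk.isClosed.measurableSet hX0
    hXk.measure_ne_top hq (Real.exp_pos _)
    (Real.exp_le_one_iff.mpr (by have := Real.sqrt_nonneg (d : ℝ); linarith)) ?_
  refine (lintegral_measure_diff_sampleHull_le_of_isSimplicialPolytope hX ho
    (finrank_euclideanSpace_fin) (by omega) hm hind hq hN).trans ?_
  gcongr
  -- The error `(2d + 3) exp (-2d)` is at most `exp (-d)`, hence at most `exp (-√d)`.
  have h1 : 2 * (d : ℝ) + 3 ≤ Real.exp d := by
    nlinarith [Real.quadratic_le_exp_of_nonneg (show (0 : ℝ) ≤ d by linarith)]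
  have h2 : √(d : ℝ) ≤ d := Real.sqrt_le_iff.mpr ⟨by linarith, by nlinarith⟩
  calc (2 * (d : ℝ) + 3) * Real.exp (-(2 * d)) ≤ Real.exp d * Real.exp (-(2 * d)) := by gcongr
    _ = Real.exp (-d) := by rw [← Real.exp_add]; congr 1; ring
    _ ≤ Real.exp (-√(d : ℝ)) := Real.exp_le_exp.mpr (by linarith)
    _ = Real.exp (-(1 / 2) * √(d : ℝ)) ^ 2 := by
        rw [← Real.exp_nat_mul]; congr 1; push_cast; ring
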